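/- **Definitions.** Let $A,B$ be boolean algebras. A *subordination* is a relation $S\subseteq A\times B$ such that $0\mathrel S0$ and $1\mathrel S1$; $a\mathrel Sc$ and $b\mathrel Sc$ imply $(a\vee b)\mathrel Sc$; $a\mathrel Sc$ and $a\mathrel Sd$ imply $a\mathrel S(c\wedge d)$; and $a\le b\mathrel Sc\le d$ implies $a\mathrel Sd$. An *$\mathsf{S5}$-subordination algebra* is a pair $\mathbf B=(B,S)$ where $S$ is a subordination on the boolean algebra $B$ (from $B$ to $B$) such that $a\mathrel Sb$ implies $a\le b$; $a\mathrel Sb$ implies $\neg b\mathrel S\neg a$; and $a\mathrel Sb$ implies $a\mathrel Sc\mathrel Sb$ for some $c\in B$. It is a *de Vries algebra* if, moreover, $B$ is complete and for every $a\ne0$ there is $b\ne0$ with $b\mathrel Sa$. $\mathsf{SubS5^S}$ is the category whose objects are the $\mathsf{S5}$-subordination algebras and whose morphisms $(B_1,S_1)\to(B_2,S_2)$ are the subordinations $T\subseteq B_1\times B_2$ that are *compatible*, i.e. $S_2\circ T=T=T\circ S_1$. Composition is composition of relations and the identity of $(B,S)$ is $S$. $\mathsf{DeV^S}$ is its full subcategory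 of de Vries algebras, and $\Delta\colon\mathsf{DeV^S}\to\mathsf{SubS5^S}$ is the inclusion functor. In a frame $L$ let $a^*$ be the pseudocomplement of $a$ and write $a\prec b$ if $a^*\vee b=1$. $L$ is *compact* if $1$ is a compact element and *regular* if $a=\bigvee\{x\in L\mid x\prec a\}$ for all $a\in L$. $\mathsf{KRFrm^P}$ is the category of compact regular frames and maps that preserve finite meets and directed joins. A *round ideal* of $\mathbf B=(B,S)$ is an ideal $I$ of $B$ such that every $a\in I$ satisfies $a\mathrel Sb$ for some $b\in I$. The contravariant functor $\mathcal{RI}\colon\mathsf{SubS5^S}\to\mathsf{KRFrm^P}$ sends $\mathbf B$ to the frame of its round ideals ordered by inclusion and $T\colon\mathbf B_1\to\mathbf B_2$ to the map $I\mapsto T^{-1}[I]=\{a\mid a\mathrel Tb\text{ for some }b\in I\}$. The contravariant functor $\mathfrak B\colon\mathsf{KRFrm^P}\to\mathsf{DeV^S}$ sends $L$ to the boolean algebra $\mathfrak BL=\{a\in L\mid a=a^{**}\}$ (with the order of $L$) equipped with the restriction of $\prec$, and $\Box\colon L\to M$ to the relation $\mathfrak B(\Box)\colon\mathfrak BM\to\mathfrak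 BL$ given by $b\mathrel{\mathfrak B(\Box)}a$ iff $b\prec\Box a$. Let $\mathcal{NI}=\mathfrak B\circ\mathcal{RI}\colon\mathsf{SubS5^S}\to\mathsf{DeV^S}$ (the *MacNeille completion functor*). For an $\mathsf{S5}$-subordination algebra $\mathbf B$ let $Q_{\mathbf B}\colon\mathbf B\to\mathcal{NI}(\mathbf B)$ be the relation given by $a\mathrel{Q_{\mathbf B}}I$ iff $a\in I$. **Theorem.** The functors $\mathcal{NI}\colon\mathsf{SubS5^S}\to\mathsf{DeV^S}$ and $\Delta\colon\mathsf{DeV^S}\to\mathsf{SubS5^S}$ are quasi-inverses of each other. Precisely: the relations $Q_{\mathbf B}$ ($\mathbf B\in\mathsf{SubS5^S}$) are the components of a natural isomorphism $1_{\mathsf{SubS5^S}}\to\Delta\circ\mathcal{NI}$, and the relations $Q_{\mathbf B}$ ($\mathbf B\in\mathsf{DeV^S}$) are the components of a natural isomorphism $1_{\mathsf{DeV^S}}\to\mathcal{NI}\circ\Delta$. Thus $\mathsf{SubS5^S}$ and $\mathsf{DeV^S}$ are equivalent, by an equivalence consisting of $\mathcal{NI}$ and $\Delta$. -/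

import Mathlib

open CategoryTheory Opposite

universe u

namespace SubordinationAlgebra

/-! ### Subordinations -/

/-- A subordination relation between boolean algebras. -/
structure IsSubordination {A B : Type*} [BooleanAlgebra A] [BooleanAlgebra B]
    (S : A → B → Prop) : Prop where
  bot_bot : S ⊥ ⊥
  top_top : S ⊤ ⊤
  sup_left : ∀ {a b c}, S a c → S b c → S (a ⊔ b) c
  inf_right : ∀ {a c d}, S a c → S a d → S a (c ⊓ d)
  mono : ∀ {a b c d}, a ≤ b → S b c → c ≤ d → S a d

/-- An S5-subordination on a boolean algebra. -/
structure IsS5Subordination {B : Type*} [BooleanAlgebra B] (S : B → B → Prop) : Prop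
    extends IsSubordination S where
  le_of_rel : ∀ {a b}, S a b → a ≤ b
  compl : ∀ {a b}, S a b → S bᶜ aᶜ
  dense : ∀ {a b}, S a b → ∃ c, S a c ∧ S c b

/-- S5-subordination algebras. -/
structure SubS5 : Type (u + 1) where
  carrier : Type u
  [str : BooleanAlgebra carrier]
  rel : carrier → carrier → Prop
  isS5 : IsS5Subordination rel

attribute [instance] SubS5.str

/-- Compatible subordinations `T : B₁ → B₂`: subordinations with `S₂ ∘ T = T = T ∘ S₁`.
(`Relation.Comp R R'` is the relational composition `R' ∘ R`.) -/
@[ext]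
structure SubS5.Hom (B₁ B₂ : SubS5.{u}) : Type u where
  rel : B₁.carrier → B₂.carrier → Prop
  isSub : IsSubordination rel
  comp_right : Relation.Comp rel B₂.rel = rel
  comp_left : Relation.Comp B₁.rel rel = rel

theorem IsS5Subordination.comp_self {B : Type*} [BooleanAlgebra B] {S : B → B → Prop}
    (h : IsS5Subordination S) : Relation.Comp S S = S := by
  funext a b
  apply propext
  constructor
  · rintro ⟨c, hac, hcb⟩
    exact h.mono (h.le_of_rel hac) hcb le_rfl
  · exact h.dense

theorem IsSubordination.comp {A B C : Type*} [BooleanAlgebra A] [BooleanAlgebra B]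
    [BooleanAlgebra C] {S : A → B → Prop} {T : B → C → Prop}
    (hS : IsSubordination S) (hT : IsSubordination T) :
    IsSubordination (Relation.Comp S T) where
  bot_bot := ⟨⊥, hS.bot_bot, hT.bot_bot⟩
  top_top := ⟨⊤, hS.top_top, hT.top_top⟩
  sup_left := by
    rintro a b c ⟨x, hx, hx'⟩ ⟨y, hy, hy'⟩
    exact ⟨x ⊔ y, hS.sup_left (hS.mono le_rfl hx le_sup_left) (hS.mono le_rfl hy le_sup_right),
      hT.sup_left hx' hy'⟩
  inf_right := by
    rintro a c d ⟨x, hx, hx'⟩ ⟨y, hy, hy'⟩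
    exact ⟨x ⊓ y, hS.inf_right hx hy,
      hT.inf_right (hT.mono inf_le_left hx' le_rfl) (hT.mono inf_le_right hy' le_rfl)⟩
  mono := by
    rintro a b c d hab ⟨x, hx, hx'⟩ hcd
    exact ⟨x, hS.mono hab hx le_rfl, hT.mono le_rfl hx' hcd⟩

/-- The category of S5-subordination algebras and compatible subordinations: composition is
composition of relations, and the identity of `(B, S)` is `S`. -/
instance : Category SubS5.{u} where
  Hom := SubS5.Hom
  id B := ⟨B.rel, B.isS5.toIsSubordination, B.isS5.comp_self, B.isS5.comp_self⟩
  comp {_ _ _} T T' :=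
    { rel := Relation.Comp T.rel T'.rel
      isSub := T.isSub.comp T'.isSub
      comp_right := by rw [Relation.comp_assoc, T'.comp_right]
      comp_left := by rw [← Relation.comp_assoc, T.comp_left] }
  id_comp T := SubS5.Hom.ext T.comp_left
  comp_id T := SubS5.Hom.ext T.comp_right
  assoc _ _ _ := SubS5.Hom.ext Relation.comp_assoc

/-- The object property of being a de Vries algebra: the boolean algebra is complete and every
nonzero `a` has a nonzero `b` with `b S a`. -/
def IsDeVries : ObjectProperty SubS5.{u} := fun B =>
  (∀ s : Set B.carrier, ∃ x, IsLUB s x) ∧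
    ∀ a : B.carrier, a ≠ ⊥ → ∃ b, b ≠ ⊥ ∧ B.rel b a

/-- The full subcategory of de Vries algebras. -/
abbrev DeVS : Type (u + 1) := IsDeVries.{u}.FullSubcategory

/-- The inclusion functor `Δ`. -/
abbrev Δ : DeVS.{u} ⥤ SubS5.{u} := IsDeVries.{u}.ι

/-! ### Compact regular frames and preframe homomorphisms -/

/-- The well-inside relation of a frame. -/
def WellInside {L : Type*} [Order.Frame L] (a b : L) : Prop := aᶜ ⊔ b = ⊤

/-- Compact regular frames. -/
structure KRFrmP : Type (u + 1) where
  carrier : Type u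
  [str : Order.Frame carrier]
  compact : IsCompactElement (⊤ : carrier)
  regular : ∀ a : carrier, a = sSup {x | WellInside x a}

attribute [instance] KRFrmP.str

/-- Preframe homomorphisms: maps preserving finite meets and directed joins. -/
@[ext]
structure PreframeHom (L M : Type u) [Order.Frame L] [Order.Frame M] : Type u where
  toFun : L → M
  map_top : toFun ⊤ = ⊤
  map_inf : ∀ a b, toFun (a ⊓ b) = toFun a ⊓ toFun b
  map_sSup : ∀ s : Set L, s.Nonempty → DirectedOn (· ≤ ·) s →
    toFun (sSup s) = sSup (toFun '' s)

theorem PreframeHom.monotone {L M : Type u} [Order.Frame L] [Order.Frame M]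
    (f : PreframeHom L M) : Monotone f.toFun := fun a b hab => by
  have := f.map_inf a b
  rw [inf_eq_left.2 hab] at this
  exact inf_eq_left.1 this.symm

/-- The category of compact regular frames and preframe homomorphisms. -/
instance : Category KRFrmP.{u} where
  Hom L M := PreframeHom L.carrier M.carrier
  id L := ⟨id, rfl, fun _ _ => rfl, fun s _ _ => by simp⟩
  comp {_ _ _} f g :=
    { toFun := g.toFun ∘ f.toFun
      map_top := by simp [f.map_top, g.map_top]
      map_inf := fun a b => by simp [f.map_inf, g.map_inf]
      map_sSup := fun s hs hd => by
        have hmono := f.monotone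
        have hd' : DirectedOn (· ≤ ·) (f.toFun '' s) := by
          rintro _ ⟨x, hx, rfl⟩ _ ⟨y, hy, rfl⟩
          obtain ⟨z, hz, hxz, hyz⟩ := hd x hx y hy
          exact ⟨_, ⟨z, hz, rfl⟩, hmono hxz, hmono hyz⟩
        simp only [Function.comp_apply]
        rw [f.map_sSup s hs hd, g.map_sSup _ (hs.image _) hd', Set.image_image] }

/-! ### Round ideals -/

/-- Round ideals of an S5-subordination algebra. -/
structure RoundIdeal (B : SubS5.{u}) : Type u where
  ideal : Order.Ideal B.carrier
  round : ∀ a ∈ ideal, ∃ b ∈ ideal, B.rel a b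

namespace RoundIdeal

variable {B B₁ B₂ : SubS5.{u}}

instance : Membership B.carrier (RoundIdeal B) := ⟨fun I a => a ∈ I.ideal⟩

theorem mem_def {I : RoundIdeal B} {a : B.carrier} : a ∈ I ↔ a ∈ I.ideal := Iff.rfl

theorem ideal_injective : Function.Injective (ideal : RoundIdeal B → _) := by
  rintro ⟨I, hI⟩ ⟨J, hJ⟩ h
  cases h
  rfl

/-- Round ideals are ordered by inclusion. -/
instance : PartialOrder (RoundIdeal B) := PartialOrder.lift ideal ideal_injective

theorem le_def {I J : RoundIdeal B} : I ≤ J ↔ ∀ a ∈ I, a ∈ J := Iff.rfl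

theorem ext {I J : RoundIdeal B} (h : ∀ a, a ∈ I ↔ a ∈ J) : I = J :=
  le_antisymm (fun a ha => (h a).1 ha) (fun a ha => (h a).2 ha)

theorem lower {I : RoundIdeal B} {a b : B.carrier} (h : a ≤ b) (hb : b ∈ I) : a ∈ I :=
  I.ideal.lower h hb

theorem sup_mem {I : RoundIdeal B} {a b : B.carrier} (ha : a ∈ I) (hb : b ∈ I) :
    a ⊔ b ∈ I := Order.Ideal.sup_mem ha hb

theorem bot_mem (I : RoundIdeal B) : (⊥ : B.carrier) ∈ I := Order.Ideal.bot_mem _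

/-- An ideal from a set containing `⊥` and closed under lower elements and binary joins. -/
def mkIdeal {P : Type*} [BooleanAlgebra P] (s : Set P) (h0 : ⊥ ∈ s)
    (hl : ∀ a b, a ≤ b → b ∈ s → a ∈ s) (hs : ∀ a ∈ s, ∀ b ∈ s, a ⊔ b ∈ s) :
    Order.Ideal P where
  carrier := s
  lower' := fun a b hab ha => hl b a hab ha
  nonempty' := ⟨⊥, h0⟩
  directed' := fun a ha b hb => ⟨a ⊔ b, hs a ha b hb, le_sup_left, le_sup_right⟩

/-- The ideal `T⁻¹[K]`, for a subordination `T` and an ideal `K`. -/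
def preimageIdeal {T : B₁.carrier → B₂.carrier → Prop} (hT : IsSubordination T)
    (K : Order.Ideal B₂.carrier) : Order.Ideal B₁.carrier :=
  mkIdeal {a | ∃ b ∈ K, T a b} ⟨⊥, Order.Ideal.bot_mem _, hT.bot_bot⟩
    (fun _ _ h ⟨c, hc, hbc⟩ => ⟨c, hc, hT.mono h hbc le_rfl⟩)
    (fun _ ⟨c, hc, hac⟩ _ ⟨d, hd, hbd⟩ => ⟨c ⊔ d, Order.Ideal.sup_mem hc hd,
      hT.sup_left (hT.mono le_rfl hac le_sup_left) (hT.mono le_rfl hbd le_sup_right)⟩)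

/-- The join of a set of round ideals is the ideal generated by their union. -/
instance : SupSet (RoundIdeal B) where
  sSup s :=
    { ideal := sSup (ideal '' s)
      round := by
        have h : sSup (ideal '' s) ≤
            preimageIdeal B.isS5.toIsSubordination (sSup (ideal '' s)) := by
          apply sSup_le
          rintro _ ⟨I, hI, rfl⟩ a ha
          obtain ⟨b, hb, hab⟩ := I.round a ha
          exact ⟨b, (le_sSup (Set.mem_image_of_mem ideal hI) : _) hb, hab⟩
        exact fun _ ha => h ha }

theorem isLUB_sSup' (s : Set (RoundIdeal B)) : IsLUB s (sSup s) := by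
  constructor
  · intro I hI
    exact (le_sSup (Set.mem_image_of_mem ideal hI) : I.ideal ≤ _)
  · intro J hJ
    apply (sSup_le _ : sSup (ideal '' s) ≤ J.ideal)
    rintro _ ⟨I, hI, rfl⟩
    exact hJ hI

/-- The binary meet of round ideals is their intersection. -/
instance : Min (RoundIdeal B) where
  min I J :=
    { ideal := I.ideal ⊓ J.ideal
      round := by
        rintro a ⟨hI, hJ⟩
        obtain ⟨b, hb, hab⟩ := I.round a hI
        obtain ⟨c, hc, hac⟩ := J.round a hJ
        exact ⟨b ⊓ c, ⟨I.ideal.lower inf_le_left hb, J.ideal.lower inf_le_right hc⟩,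
          B.isS5.inf_right hab hac⟩ }

theorem mem_inf {I J : RoundIdeal B} {a : B.carrier} : a ∈ I ⊓ J ↔ a ∈ I ∧ a ∈ J := Iff.rfl

instance : Top (RoundIdeal B) where
  top := ⟨⊤, fun _ _ => ⟨⊤, trivial, B.isS5.mono le_top B.isS5.top_top le_rfl⟩⟩

theorem mem_top (a : B.carrier) : a ∈ (⊤ : RoundIdeal B) := trivial

instance : CompleteLattice (RoundIdeal B) where
  __ := completeLatticeOfSup (RoundIdeal B) isLUB_sSup'
  inf := (· ⊓ ·)
  inf_le_left _ _ := fun _ h => h.1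
  inf_le_right _ _ := fun _ h => h.2
  le_inf _ _ _ h h' := fun _ ha => ⟨h ha, h' ha⟩
  top := ⊤
  le_top _ := fun _ _ => trivial

theorem frame_aux (I : RoundIdeal B) (s : Set (RoundIdeal B)) :
    I ⊓ sSup s ≤ ⨆ J ∈ s, I ⊓ J := by
  set M : RoundIdeal B := ⨆ J ∈ s, I ⊓ J with hM
  let K : Order.Ideal B.carrier := mkIdeal {x | ∀ y ∈ I, x ⊓ y ∈ M}
    (fun y _ => by simpa using M.bot_mem)
    (fun a b hab hb y hy => lower (inf_le_inf_right y hab) (hb y hy))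
    (fun a ha b hb y hy => by
      rw [inf_sup_right]
      exact sup_mem (ha y hy) (hb y hy))
  have hK : sSup (ideal '' s) ≤ K := by
    apply sSup_le
    rintro _ ⟨J, hJ, rfl⟩ x hx y hy
    have hle : I ⊓ J ≤ M := le_iSup₂_of_le J hJ le_rfl
    exact hle ⟨lower inf_le_right hy, lower inf_le_left (mem_def.2 hx)⟩
  rintro a ⟨haI, haS⟩
  have h : a ⊓ a ∈ M := hK haS a haI
  rwa [inf_idem] at h

/-- The frame of round ideals, ordered by inclusion. -/
instance : Order.Frame (RoundIdeal B) := Order.Frame.ofMinimalAxioms ⟨frame_aux⟩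

theorem mem_sSup_of_directed {s : Set (RoundIdeal B)} (hs : s.Nonempty)
    (hd : DirectedOn (· ≤ ·) s) {a : B.carrier} : a ∈ sSup s ↔ ∃ I ∈ s, a ∈ I := by
  constructor
  · let K : Order.Ideal B.carrier := mkIdeal {x | ∃ I ∈ s, x ∈ I}
      (let ⟨I, hI⟩ := hs; ⟨I, hI, I.bot_mem⟩)
      (fun _ _ hab ⟨I, hI, hb⟩ => ⟨I, hI, lower hab hb⟩)
      (fun _ ⟨I, hI, ha⟩ _ ⟨J, hJ, hb⟩ => by
        obtain ⟨M, hM, hIM, hJM⟩ := hd I hI J hJ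
        exact ⟨M, hM, sup_mem (hIM ha) (hJM hb)⟩)
    have hK : sSup (ideal '' s) ≤ K := by
      apply sSup_le
      rintro _ ⟨J, hJ, rfl⟩ x hx
      exact ⟨J, hJ, hx⟩
    exact fun h => hK h
  · rintro ⟨I, hI, ha⟩
    exact (le_sSup hI : I ≤ sSup s) ha

theorem compact_top : IsCompactElement (⊤ : RoundIdeal B) := by
  intro s u hs hd hu htop
  rw [hu.unique (isLUB_sSup s)] at htop
  obtain ⟨I, hI, h⟩ := (mem_sSup_of_directed hs hd).1 (htop (mem_top ⊤))
  exact ⟨I, hI, fun a _ => lower le_top h⟩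

/-- The round ideal `T⁻¹[I]`, for a compatible subordination `T` and a round ideal `I`. -/
def preimage (T : B₁ ⟶ B₂) (I : RoundIdeal B₂) : RoundIdeal B₁ where
  ideal := preimageIdeal T.isSub I.ideal
  round := by
    rintro a ⟨b, hb, hab⟩
    rw [← T.comp_left] at hab
    obtain ⟨c, hac, hcb⟩ := hab
    exact ⟨c, ⟨b, hb, hcb⟩, hac⟩

theorem mem_preimage {T : B₁ ⟶ B₂} {I : RoundIdeal B₂} {a : B₁.carrier} :
    a ∈ preimage T I ↔ ∃ b ∈ I, T.rel a b := Iff.rfl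

theorem regular (J : RoundIdeal B) : J = sSup {I | WellInside I J} := by
  apply le_antisymm
  · intro a ha
    obtain ⟨b, hb, hab⟩ := J.round a ha
    obtain ⟨c, hc, hbc⟩ := J.round b hb
    let down : B.carrier → RoundIdeal B := fun x =>
      { ideal := preimageIdeal B.isS5.toIsSubordination (Order.Ideal.principal x)
        round := by
          rintro y ⟨z, hz, hyz⟩
          obtain ⟨w, hyw, hwz⟩ := B.isS5.dense hyz
          exact ⟨w, ⟨z, hz, hwz⟩, hyw⟩ }
    have hdown : ∀ x, ∀ y ∈ down x, y ≤ x := by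
      rintro x y ⟨z, hz, hyz⟩
      exact (B.isS5.le_of_rel hyz).trans hz
    have hI : WellInside (down b) J := by
      have h1 : down bᶜ ≤ (down b)ᶜ := by
        rw [le_compl_iff_disjoint_right, disjoint_iff_inf_le]
        rintro y ⟨hy, hy'⟩
        have h : y ≤ ⊥ := by
          rw [← inf_compl_eq_bot (a := b)]
          exact le_inf (hdown _ _ hy') (hdown _ _ hy)
        exact lower h (bot_mem _)
      rw [WellInside, eq_top_iff]
      intro x _
      have hc1 : cᶜ ∈ (down b)ᶜ ⊔ J :=
        (le_sup_left : _ ≤ (down b)ᶜ ⊔ J) (h1 ⟨bᶜ, le_refl (bᶜ), B.isS5.compl hbc⟩)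
      have hc2 : c ∈ (down b)ᶜ ⊔ J := (le_sup_right : J ≤ (down b)ᶜ ⊔ J) hc
      exact lower (le_top.trans (compl_sup_eq_top (x := c)).ge) (sup_mem hc1 hc2)
    have hle : down b ≤ sSup {I | WellInside I J} := le_sSup hI
    exact hle ⟨b, le_refl b, hab⟩
  · apply sSup_le
    intro I hI
    have h : I = I ⊓ J := by
      have := congrArg (I ⊓ ·) (show Iᶜ ⊔ J = ⊤ from hI)
      simpa [inf_sup_left] using this.symm
    rw [h]
    exact inf_le_right

end RoundIdeal

/-- The contravariant round ideal functor: `B ↦ RI(B)` and `T ↦ (I ↦ T⁻¹[I])`. -/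
def RI : SubS5.{u} ⥤ KRFrmP.{u}ᵒᵖ where
  obj B := op ⟨RoundIdeal B, RoundIdeal.compact_top, RoundIdeal.regular⟩
  map {B₁ B₂} T := Quiver.Hom.op
    ({ toFun := RoundIdeal.preimage T
       map_top := RoundIdeal.ext fun a =>
         ⟨fun _ => trivial, fun _ => ⟨⊤, trivial, T.isSub.mono le_top T.isSub.top_top le_rfl⟩⟩
       map_inf := fun I J => RoundIdeal.ext fun a => by
         constructor
         · rintro ⟨b, ⟨hI, hJ⟩, hab⟩
           exact ⟨⟨b, hI, hab⟩, ⟨b, hJ, hab⟩⟩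
         · rintro ⟨⟨b, hb, hab⟩, ⟨c, hc, hac⟩⟩
           exact ⟨b ⊓ c, ⟨I.ideal.lower inf_le_left hb, J.ideal.lower inf_le_right hc⟩,
             T.isSub.inf_right hab hac⟩
       map_sSup := fun s hs hd => RoundIdeal.ext fun a => by
         have hd' : DirectedOn (· ≤ ·) (RoundIdeal.preimage T '' s) := by
           rintro _ ⟨I, hI, rfl⟩ _ ⟨J, hJ, rfl⟩
           obtain ⟨M, hM, hIM, hJM⟩ := hd I hI J hJ
           exact ⟨_, ⟨M, hM, rfl⟩, fun x ⟨y, hy, hxy⟩ => ⟨y, hIM hy, hxy⟩,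
             fun x ⟨y, hy, hxy⟩ => ⟨y, hJM hy, hxy⟩⟩
         rw [RoundIdeal.mem_sSup_of_directed (hs.image _) hd', RoundIdeal.mem_preimage]
         simp only [RoundIdeal.mem_sSup_of_directed hs hd, Set.exists_mem_image,
           RoundIdeal.mem_preimage]
         constructor
         · rintro ⟨b, ⟨I, hI, hb⟩, hab⟩
           exact ⟨I, hI, b, hb, hab⟩
         · rintro ⟨I, hI, b, hb, hab⟩
           exact ⟨b, ⟨I, hI, hb⟩, hab⟩ } :
      PreframeHom (RoundIdeal B₂) (RoundIdeal B₁))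
  map_id B := by
    apply Quiver.Hom.unop_inj
    apply PreframeHom.ext
    funext I
    apply RoundIdeal.ext
    intro a
    constructor
    · rintro ⟨b, hb, hab⟩
      exact RoundIdeal.lower (B.isS5.le_of_rel hab) (RoundIdeal.mem_def.2 hb)
    · exact fun ha => I.round a ha
  map_comp {B₁ B₂ B₃} T T' := by
    apply Quiver.Hom.unop_inj
    apply PreframeHom.ext
    funext I
    apply RoundIdeal.ext
    intro a
    constructor
    · rintro ⟨c, hc, b, hab, hbc⟩
      exact ⟨b, ⟨c, hc, hbc⟩, hab⟩
    · rintro ⟨b, ⟨c, hc, hbc⟩, hab⟩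
      exact ⟨c, hc, b, hab, hbc⟩

/-! ### Booleanization -/

section WellInside

variable {L : Type*} [Order.Frame L] {a b c d : L}

theorem WellInside.le (h : WellInside a b) : a ≤ b := by
  have h' := congrArg (a ⊓ ·) (show aᶜ ⊔ b = ⊤ from h)
  have : a = a ⊓ b := by simpa [inf_sup_left] using h'.symm
  rw [this]
  exact inf_le_right

theorem WellInside.mono (hab : a ≤ b) (h : WellInside b c) (hcd : c ≤ d) : WellInside a d :=
  eq_top_iff.2 (h.ge.trans (sup_le_sup (compl_le_compl hab) hcd))

theorem WellInside.compl_compl (h : WellInside a b) : WellInside aᶜᶜ b := by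
  rw [WellInside, compl_compl_compl]
  exact h

theorem WellInside.bot : WellInside (⊥ : L) b := by simp [WellInside]

theorem WellInside.top : WellInside a (⊤ : L) := by simp [WellInside]

theorem WellInside.sup (h : WellInside a c) (h' : WellInside b c) : WellInside (a ⊔ b) c := by
  unfold WellInside at *
  rw [compl_sup, sup_inf_right, h, h', inf_top_eq]

theorem WellInside.inf (h : WellInside a b) (h' : WellInside a c) : WellInside a (b ⊓ c) := by
  unfold WellInside at *
  rw [sup_inf_left, h, h', inf_top_eq]

theorem WellInside.compl (h : WellInside a b) : WellInside bᶜ aᶜ :=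
  eq_top_iff.2 (by
    rw [← show aᶜ ⊔ b = ⊤ from h, sup_comm]
    exact sup_le_sup le_compl_compl le_rfl)

end WellInside

/-- The relation `b 𝔅(□) a ↔ b ≺ □ a` between booleanizations. (`Heyting.Regular L` is the
boolean algebra of all `a : L` with `aᶜᶜ = a`.) -/
def boolRel {L M : Type u} [Order.Frame L] [Order.Frame M] (f : PreframeHom L M) :
    Heyting.Regular M → Heyting.Regular L → Prop :=
  fun b a => WellInside (b : M) (f.toFun a)

theorem boolRel_isSubordination {L M : Type u} [Order.Frame L] [Order.Frame M]
    (f : PreframeHom L M) : IsSubordination (boolRel f) where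
  bot_bot := WellInside.bot
  top_top := by
    have h : f.toFun ((⊤ : Heyting.Regular L) : L) = ⊤ := f.map_top
    rw [boolRel, h]
    exact WellInside.top
  sup_left := fun h h' => by
    rw [boolRel, Heyting.Regular.coe_sup]
    exact (WellInside.sup h h').compl_compl
  inf_right := fun {a c d} h h' => by
    have hi : WellInside (a : M) (f.toFun c ⊓ f.toFun d) := WellInside.inf h h'
    rw [← f.map_inf] at hi
    exact hi
  mono := fun h h' h'' => WellInside.mono h h' (f.monotone h'')

/-- If `b ≺ □ a` then `b ≺ □ c` for some regular `c ≺ a`. -/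
theorem interpolate {L M : KRFrmP.{u}} (f : PreframeHom L.carrier M.carrier)
    {b : M.carrier} {a : L.carrier} (h : WellInside b (f.toFun a)) :
    ∃ c : Heyting.Regular L.carrier, WellInside b (f.toFun c) ∧ WellInside (c : L.carrier) a := by
  let s : Set L.carrier := {x | WellInside x a}
  have hs : s.Nonempty := ⟨⊥, WellInside.bot⟩
  have hd : DirectedOn (· ≤ ·) s := fun x hx y hy =>
    ⟨x ⊔ y, WellInside.sup hx hy, le_sup_left, le_sup_right⟩
  have hfa : f.toFun a = sSup (f.toFun '' s) := by
    rw [← f.map_sSup s hs hd, ← L.regular a]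
  let t : Set M.carrier := (fun x => bᶜ ⊔ f.toFun x) '' s
  have ht : DirectedOn (· ≤ ·) t := by
    rintro _ ⟨x, hx, rfl⟩ _ ⟨y, hy, rfl⟩
    obtain ⟨z, hz, hxz, hyz⟩ := hd x hx y hy
    exact ⟨_, ⟨z, hz, rfl⟩, sup_le_sup_left (f.monotone hxz) _,
      sup_le_sup_left (f.monotone hyz) _⟩
  have htop : ⊤ ≤ sSup t := by
    rw [← show bᶜ ⊔ f.toFun a = ⊤ from h, hfa]
    apply sup_le
    · obtain ⟨x, hx⟩ := hs
      exact le_trans le_sup_left (le_sSup (show bᶜ ⊔ f.toFun x ∈ t from ⟨x, hx, rfl⟩))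
    · apply sSup_le
      rintro _ ⟨x, hx, rfl⟩
      exact le_trans le_sup_right (le_sSup (show bᶜ ⊔ f.toFun x ∈ t from ⟨x, hx, rfl⟩))
  obtain ⟨_, ⟨x, hx, rfl⟩, hx'⟩ := M.compact t _ (hs.image _) ht (isLUB_sSup t) htop
  refine ⟨⟨xᶜᶜ, Heyting.isRegular_compl _⟩, ?_, ?_⟩
  · exact WellInside.mono le_rfl (top_le_iff.1 hx') (f.monotone le_compl_compl)
  · exact WellInside.compl_compl hx

/-- If `b ≺ a` then `b ≺ c ≺ a` for some regular `c`. -/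
theorem interpolate_id {L : KRFrmP.{u}} {a b : L.carrier} (h : WellInside b a) :
    ∃ c : Heyting.Regular L.carrier, WellInside b c ∧ WellInside (c : L.carrier) a :=
  interpolate (M := L) ⟨id, rfl, fun _ _ => rfl, fun s _ _ => by simp⟩ h

/-- The booleanization of a compact regular frame, with the restriction of the well-inside
relation. -/
def boolObj (L : KRFrmP.{u}) : SubS5.{u} where
  carrier := Heyting.Regular L.carrier
  rel b a := WellInside (b : L.carrier) a
  isS5 :=
    { boolRel_isSubordination
        (⟨id, rfl, fun _ _ => rfl, fun s _ _ => by simp⟩ :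
          PreframeHom L.carrier L.carrier) with
      le_of_rel := fun h => WellInside.le h
      compl := fun h => WellInside.compl h
      dense := fun h => interpolate_id h }

theorem boolObj_isDeVries (L : KRFrmP.{u}) : IsDeVries (boolObj L) := by
  constructor
  · intro (s : Set (Heyting.Regular L.carrier))
    let j : L.carrier := sSup (Heyting.Regular.val '' s)
    refine ⟨(⟨jᶜᶜ, Heyting.isRegular_compl _⟩ : Heyting.Regular L.carrier), ?_, ?_⟩
    · intro a ha
      have h : Heyting.Regular.val a ≤ j := le_sSup (Set.mem_image_of_mem _ ha)
      exact (h.trans le_compl_compl : Heyting.Regular.val a ≤ jᶜᶜ)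
    · intro (b : Heyting.Regular L.carrier) hb
      have h : j ≤ Heyting.Regular.val b := by
        apply sSup_le
        rintro _ ⟨a, ha, rfl⟩
        exact hb ha
      have h' : jᶜᶜ ≤ (Heyting.Regular.val b)ᶜᶜ := compl_le_compl (compl_le_compl h)
      exact (h'.trans b.2.le : jᶜᶜ ≤ Heyting.Regular.val b)
  · intro (a : Heyting.Regular L.carrier) ha
    by_contra! hcon
    apply ha
    have h0 : Heyting.Regular.val a ≤ ⊥ := by
      rw [L.regular (Heyting.Regular.val a)]
      apply sSup_le
      intro x hx
      by_contra hx0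
      refine hcon (⟨xᶜᶜ, Heyting.isRegular_compl _⟩ : Heyting.Regular L.carrier) ?_
        (WellInside.compl_compl hx)
      intro h
      apply hx0
      have h' : xᶜᶜ = ⊥ := congrArg Heyting.Regular.val h
      exact le_compl_compl.trans h'.le
    exact Heyting.Regular.coe_injective (le_bot_iff.1 h0)

/-- The contravariant booleanization functor `𝔅`. -/
def Booleanization : KRFrmP.{u}ᵒᵖ ⥤ DeVS.{u} where
  obj L := ⟨boolObj L.unop, boolObj_isDeVries L.unop⟩
  map {X Y} f := ObjectProperty.homMk
    { rel := boolRel (L := Y.unop.carrier) (M := X.unop.carrier) f.unop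
      isSub := boolRel_isSubordination _
      comp_right := by
        funext b a
        apply propext
        constructor
        · rintro ⟨c, hbc, hca⟩
          exact WellInside.mono le_rfl hbc (PreframeHom.monotone _ (WellInside.le hca))
        · exact fun h => interpolate (L := Y.unop) (M := X.unop) f.unop h
      comp_left := by
        funext b a
        apply propext
        constructor
        · rintro ⟨c, hbc, hca⟩
          exact WellInside.mono (WellInside.le hbc) hca le_rfl
        · exact fun h => interpolate_id (L := X.unop) h }
  map_id X := by
    apply ObjectProperty.hom_ext
    apply SubS5.Hom.ext
    rfl
  map_comp {X Y Z} f g := by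
    apply ObjectProperty.hom_ext
    apply SubS5.Hom.ext
    funext c a
    apply propext
    constructor
    · intro h
      obtain ⟨b, hb, hba⟩ := interpolate (L := Y.unop) (M := X.unop) f.unop h
      exact ⟨b, hb, hba⟩
    · rintro ⟨b, hcb, hba⟩
      exact WellInside.mono le_rfl hcb (PreframeHom.monotone _ (WellInside.le hba))

/-- The MacNeille completion functor `NI = 𝔅 ∘ RI`. -/
def NI : SubS5.{u} ⥤ DeVS.{u} := RI ⋙ Booleanization

/-- The underlying round ideal of an element of `NI(B)`. -/
def NI.toRoundIdeal {B : SubS5.{u}} (I : (NI.obj B).obj.carrier) : RoundIdeal B :=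
  Heyting.Regular.val (α := RoundIdeal B) I

/-- The relation `Q_B` between `B` and `NI(B)`: `a Q_B I` iff `a ∈ I`. -/
def Q (B : SubS5.{u}) (a : B.carrier) (I : (NI.obj B).obj.carrier) : Prop :=
  a ∈ NI.toRoundIdeal I

end SubordinationAlgebra

/-!
For round ideals `I` and `J`, `I ≺ J` holds iff some element of `J` is an upper bound of `I`: the
elements of `Iᶜ` are those `a` with `a S bᶜ` for an upper bound `b` of `I`. With `↡b = {a | a S b}`,
two interpolation properties of a round ideal `J` follow:

* `a ∈ J` iff `a ∈ I ≺ J` for some regular round ideal `I`, namely `(↡b)ᶜᶜ` for `a S b ∈ J`;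
* `I ≺ J` iff `I ≺ ↡b` for some `b ∈ J`.

Let `R_B` relate `I` to `b` when `I ≺ ↡b`. The first property says `Q_B ; S_NI = Q_B` as it stands
and `Q_B ; R_B = S` for `J = ↡b`; for `J = T⁻¹[K]` it gives naturality, as `NI(T)` relates `I` to
`K` iff `I ≺ T⁻¹[K]`. The second says `R_B ; Q_B = S_NI` as it stands and `R_B ; S = R_B` for
`J = ↡b`.
-/

namespace SubordinationAlgebra

namespace RoundIdeal

variable {B : SubS5.{u}} {I J : RoundIdeal B} {a b : B.carrier}

theorem mem_bot : a ∈ (⊥ : RoundIdeal B) ↔ a = ⊥ := by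
  have ideal_bot : (⊥ : RoundIdeal B).ideal = ⊥ := by
    change sSup (ideal '' ∅) = ⊥
    rw [Set.image_empty, sSup_empty]
  rw [mem_def, ideal_bot, ← le_bot_iff]
  rfl

theorem mem_sup : a ∈ I ⊔ J ↔ ∃ x ∈ I, ∃ y ∈ J, a ≤ x ⊔ y := by
  have ideal_sup : (I ⊔ J).ideal = I.ideal ⊔ J.ideal := by
    change sSup (ideal '' {I, J}) = _
    rw [Set.image_pair, sSup_pair]
  rw [mem_def, ideal_sup, Order.Ideal.mem_sup]
  rfl

theorem eq_top_iff_top_mem : I = ⊤ ↔ ⊤ ∈ I :=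
  ⟨fun h => h ▸ mem_top ⊤, fun h => eq_top_iff.2 fun _ _ => lower le_top h⟩

theorem mem_iff_exists_rel : a ∈ I ↔ ∃ b, B.rel a b ∧ b ∈ I :=
  ⟨fun ha => let ⟨b, hb, hab⟩ := I.round a ha; ⟨b, hab, hb⟩,
    fun ⟨_, hab, hb⟩ => lower (B.isS5.le_of_rel hab) hb⟩

/-- The round ideal `↡b` of all `a` with `a S b`; it is round because `S` is dense. -/
def below (b : B.carrier) : RoundIdeal B where
  ideal := mkIdeal {a | B.rel a b} (B.isS5.mono le_rfl B.isS5.bot_bot bot_le)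
    (fun _ _ hac hcb => B.isS5.mono hac hcb le_rfl) (fun _ ha _ hc => B.isS5.sup_left ha hc)
  round _ hab := let ⟨c, hac, hcb⟩ := B.isS5.dense hab; ⟨c, hcb, hac⟩

theorem le_of_mem_below (h : a ∈ below b) : a ≤ b := B.isS5.le_of_rel h

theorem below_le (hb : b ∈ I) : below b ≤ I := fun _ ha => lower (le_of_mem_below ha) hb

theorem below_mono : Monotone (below : B.carrier → RoundIdeal B) :=
  fun _ _ hbc _ ha => B.isS5.mono le_rfl ha hbc

theorem below_top : below (⊤ : B.carrier) = ⊤ := eq_top_iff_top_mem.2 B.isS5.top_top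

theorem below_inf (a b : B.carrier) : below (a ⊓ b) = below a ⊓ below b :=
  le_antisymm (le_inf (below_mono inf_le_left) (below_mono inf_le_right))
    fun _ h => B.isS5.inf_right h.1 h.2

theorem mem_compl_iff : a ∈ Iᶜ ↔ ∃ b, (∀ x ∈ I, x ≤ b) ∧ B.rel a bᶜ := by
  constructor
  · intro ha
    obtain ⟨c, hc, hac⟩ := Iᶜ.round a ha
    refine ⟨cᶜ, fun x hx => ?_, by rwa [compl_compl]⟩
    have hxc : x ⊓ c ∈ I ⊓ Iᶜ := ⟨lower inf_le_left hx, Iᶜ.ideal.lower inf_le_right hc⟩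
    rw [inf_compl_self, mem_bot] at hxc
    exact le_compl_iff_disjoint_right.2 (disjoint_iff.2 hxc)
  · rintro ⟨b, hb, hab⟩
    have below_le_compl : below bᶜ ≤ Iᶜ := by
      rw [le_compl_iff_disjoint_right, disjoint_iff_inf_le]
      rintro y ⟨hyb, hyI⟩
      exact mem_bot.2 (le_compl_self.1 ((le_of_mem_below hyb).trans (compl_le_compl (hb y hyI))))
    exact below_le_compl hab

theorem wellInside_iff_exists_upperBound : WellInside I J ↔ ∃ b ∈ J, ∀ a ∈ I, a ≤ b := by
  rw [WellInside, eq_top_iff_top_mem, mem_sup]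
  constructor
  · rintro ⟨x, hx, y, hy, hxy⟩
    obtain ⟨b, hb, hxb⟩ := mem_compl_iff.1 hx
    have hby : b ≤ y := calc
      b ≤ xᶜ := le_compl_comm.1 (B.isS5.le_of_rel hxb)
      _ ≤ y := codisjoint_iff_compl_le_right.1 (codisjoint_iff_le_sup.2 hxy)
    exact ⟨b, lower hby hy, hb⟩
  · rintro ⟨b, hbJ, hb⟩
    obtain ⟨c, hc, hbc⟩ := J.round b hbJ
    exact ⟨cᶜ, mem_compl_iff.2 ⟨b, hb, B.isS5.compl hbc⟩, c, hc, compl_sup_eq_top.ge⟩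

theorem wellInside_below (hb : b ∈ I) : WellInside (below b) I :=
  wellInside_iff_exists_upperBound.2 ⟨b, hb, fun _ => le_of_mem_below⟩

theorem wellInside_iff_exists_below : WellInside I J ↔ ∃ b, WellInside I (below b) ∧ b ∈ J := by
  constructor
  · intro h
    obtain ⟨b, hbJ, hb⟩ := wellInside_iff_exists_upperBound.1 h
    obtain ⟨c, hc, hbc⟩ := J.round b hbJ
    exact ⟨c, wellInside_iff_exists_upperBound.2 ⟨b, hbc, hb⟩, hc⟩
  · rintro ⟨b, hIb, hb⟩
    exact hIb.mono le_rfl (below_le hb)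

theorem mem_iff_exists_regular_wellInside :
    a ∈ J ↔ ∃ I : Heyting.Regular (RoundIdeal B),
      a ∈ (I : RoundIdeal B) ∧ WellInside (I : RoundIdeal B) J := by
  constructor
  · intro ha
    obtain ⟨b, hb, hab⟩ := J.round a ha
    exact ⟨⟨(below b)ᶜᶜ, Heyting.isRegular_compl _⟩, (le_compl_compl : below b ≤ _) hab,
      (wellInside_below hb).compl_compl⟩
  · rintro ⟨I, ha, hIJ⟩
    exact hIJ.le ha

end RoundIdeal

theorem wellInside_iff_exists_regular {L : KRFrmP.{u}} {a b : L.carrier} :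
    WellInside a b ↔
      ∃ c : Heyting.Regular L.carrier, WellInside a c ∧ WellInside (c : L.carrier) b :=
  ⟨interpolate_id, fun ⟨_, hac, hcb⟩ => hac.mono le_rfl hcb.le⟩

namespace Q

open RoundIdeal

theorem isSubordination (B : SubS5.{u}) : IsSubordination (Q B) where
  bot_bot := RoundIdeal.bot_mem _
  top_top := mem_top _
  sup_left := RoundIdeal.sup_mem
  inf_right hI hJ := ⟨hI, hJ⟩
  mono hab hb hIJ := (show NI.toRoundIdeal _ ≤ NI.toRoundIdeal _ from hIJ) (lower hab hb)

theorem rel_comp (B : SubS5.{u}) : Relation.Comp B.rel (Q B) = Q B :=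
  funext₂ fun _ _ => propext mem_iff_exists_rel.symm

theorem comp_rel (B : SubS5.{u}) : Relation.Comp (Q B) (NI.obj B).obj.rel = Q B :=
  funext₂ fun _ _ => propext mem_iff_exists_regular_wellInside.symm

/-- The relation `R_B` inverse to `Q_B`: `I R_B b` iff `I ≺ ↡b`, that is, iff `c S b` for some upper
bound `c` of `I`. -/
def invRel (B : SubS5.{u}) (I : (NI.obj B).obj.carrier) (b : B.carrier) : Prop :=
  WellInside (NI.toRoundIdeal I) (below b)

theorem isSubordination_invRel (B : SubS5.{u}) : IsSubordination (invRel B) where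
  bot_bot := WellInside.bot
  top_top := by
    rw [invRel, below_top]
    exact WellInside.top
  sup_left hI hJ := (WellInside.sup hI hJ).compl_compl
  inf_right hb hc := by
    rw [invRel, below_inf]
    exact WellInside.inf hb hc
  mono hIJ hJb hbc := WellInside.mono hIJ hJb (below_mono hbc)

theorem rel_comp_invRel (B : SubS5.{u}) :
    Relation.Comp (NI.obj B).obj.rel (invRel B) = invRel B :=
  funext₂ fun _ _ => propext (wellInside_iff_exists_regular (L := (RI.obj B).unop)).symm

theorem invRel_comp_rel (B : SubS5.{u}) : Relation.Comp (invRel B) B.rel = invRel B :=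
  funext₂ fun I b => propext
    (wellInside_iff_exists_below (I := NI.toRoundIdeal I) (J := below b)).symm

theorem comp_invRel (B : SubS5.{u}) : Relation.Comp (Q B) (invRel B) = B.rel :=
  funext₂ fun _ _ => propext mem_iff_exists_regular_wellInside.symm

theorem invRel_comp (B : SubS5.{u}) : Relation.Comp (invRel B) (Q B) = (NI.obj B).obj.rel :=
  funext₂ fun _ _ => propext wellInside_iff_exists_below.symm

/-- The isomorphism `B ≅ NI(B)` of S5-subordination algebras given by `Q_B`. -/
def iso (B : SubS5.{u}) : B ≅ (NI.obj B).obj where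
  hom := ⟨Q B, isSubordination B, comp_rel B, rel_comp B⟩
  inv := ⟨invRel B, isSubordination_invRel B, invRel_comp_rel B, rel_comp_invRel B⟩
  hom_inv_id := SubS5.Hom.ext (comp_invRel B)
  inv_hom_id := SubS5.Hom.ext (invRel_comp B)

theorem naturality {B₁ B₂ : SubS5.{u}} (T : B₁ ⟶ B₂) :
    T ≫ (iso B₂).hom = (iso B₁).hom ≫ (NI.map T).hom := by
  refine SubS5.Hom.ext (funext₂ fun a K => propext ?_)
  calc (∃ b, T.rel a b ∧ b ∈ NI.toRoundIdeal K)
    _ ↔ a ∈ preimage T (NI.toRoundIdeal K) := by simp only [mem_preimage, and_comm]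
    _ ↔ ∃ I : Heyting.Regular (RoundIdeal B₁), a ∈ (I : RoundIdeal B₁) ∧
          WellInside (I : RoundIdeal B₁) (preimage T (NI.toRoundIdeal K)) :=
        mem_iff_exists_regular_wellInside

end Q

/-- The natural isomorphism `1 ≅ Δ ∘ NI` with components `Q_B`. -/
def unitIso : 𝟭 SubS5.{u} ≅ NI ⋙ Δ :=
  NatIso.ofComponents Q.iso Q.naturality

/-- The natural isomorphism `1 ≅ NI ∘ Δ` with components `Q_B`. -/
def deVriesUnitIso : 𝟭 DeVS.{u} ≅ Δ ⋙ NI :=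
  NatIso.ofComponents (fun B => IsDeVries.isoMk (Q.iso B.obj))
    fun T => ObjectProperty.hom_ext _ (Q.naturality T.hom)

/-- The equivalence between S5-subordination algebras and de Vries algebras given by MacNeille
completion and inclusion. -/
def macNeilleEquivalence : SubS5.{u} ≌ DeVS.{u} :=
  CategoryTheory.Equivalence.mk NI Δ unitIso deVriesUnitIso.symm

end SubordinationAlgebra

theorem mainTheorem1 :
    (∃ η : 𝟭 SubordinationAlgebra.SubS5.{u} ≅
        SubordinationAlgebra.NI ⋙ SubordinationAlgebra.Δ,
      ∀ B : SubordinationAlgebra.SubS5.{u},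
        (η.hom.app B).rel = SubordinationAlgebra.Q B) ∧
    (∃ η' : 𝟭 SubordinationAlgebra.DeVS.{u} ≅
        SubordinationAlgebra.Δ ⋙ SubordinationAlgebra.NI,
      ∀ B : SubordinationAlgebra.DeVS.{u},
        (η'.hom.app B).hom.rel = SubordinationAlgebra.Q B.obj) ∧
    (∃ e : SubordinationAlgebra.SubS5.{u} ≌ SubordinationAlgebra.DeVS.{u},
      e.functor = SubordinationAlgebra.NI ∧ e.inverse = SubordinationAlgebra.Δ) :=
  ⟨⟨SubordinationAlgebra.unitIso, fun _ => rfl⟩,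
    ⟨SubordinationAlgebra.deVriesUnitIso, fun _ => rfl⟩,
    ⟨SubordinationAlgebra.macNeilleEquivalence, rfl, rfl⟩⟩
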